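/- Let $V$ be a complex vector space of dimension $N$, let $U=\mathbb{C}$ with coordinate $y$, and let $\mathcal{A}\subset V^*\setminus\{0\}$ be a finite set of covectors contained in a lattice of rank $N$, with multiplicities $c_\alpha\in\mathbb{C}$ ($\alpha\in\mathcal{A}$) such that the symmetric bilinear form $G_{\mathcal{A}}(u,v)=\sum_{\alpha\in\mathcal{A}}c_\alpha\alpha(u)\alpha(v)$ on $V$ is non-degenerate. Let $\lambda\in\mathbb{C}^*$, let $f(z)=\frac{i}{6}z^3+\frac14 \mathrm{Li}_3(e^{-2iz})$ (a multivalued analytic function on $\mathbb{C}\setminus\pi\mathbb{Z}$ with $f'''(z)=\cot z$), and consider the prepotential $$F(x,y)=\tfrac13y^3+\sum_{\alpha\in\mathcal{A}}c_\alpha\alpha(x)^2y+\lambda\sum_{\alpha\in\mathcal{A}}c_\alpha f(\alpha(x)),\qquad x\in V,\ y\in U .$$ For a function $F$ on $V\oplus U$ and linear coordinates $x_1,\dots,x_N$ on $V$, $x_{N+1}=y$ on $U$, the WDVV equations are $F_iF_{N+1}^{-1}F_j=F_jF_{N+1}^{-1}F_i$ for $i,j=1,\dots,N$, where $F_i$ is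 the $(N+1)\times(N+1)$ matrix with entries $\partial^3F/\partial x_i\partial x_p\partial x_q$; they are considered at all points at which $F$ is regular, that is, at which no argument of $f$ lies in $\pi\mathbb{Z}$, and for every choice of branches of $f$. The corresponding multiplication on the tangent space at such a point is $a\ast b=\sum_{i,j,k,l}a_ib_j\,\eta^{kl}F_{ijk}\,\partial_{x_l}$, where $F_{ijk}$ are the third order partial derivatives of $F$ and $(\eta^{kl})=F_{N+1}^{-1}$. Let $\mathcal{B}=\mathcal{A}\cap W$ for some linear subspace $W\subset V^*$, let $S\subset\mathcal{B}$ be a basis of the linear span $\langle\mathcal{B}\rangle$, and let $W_{\mathcal{B}}=\bigcap_{\beta\in\mathcal{B}}\ker\beta\subset V$. Assume that the restriction $G_{\mathcal{A}}|_{W_{\mathcal{B}}}$ is non-degenerate. For $\alpha\in V^*$ write $\overline{\alpha}=\alpha|_{W_{\mathcal{B}}}$, and let $\overline{\alpha}^{\vee_{W_{\mathcal{B}}}}\in W_{\mathcal{B}}$ be the vector with $G_{\mathcal{A}}(\overline{\alpha}^{\vee_{W_{\mathcal{B}}}},v)=\overline{\alpha}(v)$ for all $v\in W_{\mathcal{B}}$.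 For $\alpha\in\mathcal{A}$ let $\delta_\alpha$ be the set of all $\gamma\in\mathcal{A}$ collinear to $\alpha$, and for $\alpha_0\in\delta_\alpha$ let $C_{\delta_\alpha}^{\alpha_0}=\sum_{\gamma\in\delta_\alpha}c_\gamma k_\gamma^2$, where $\gamma=k_\gamma\alpha_0$. Suppose that $F$ satisfies the WDVV equations and that $C_{\delta_\alpha}^{\alpha_0}\neq0$ for all $\alpha\in S$ and $\alpha_0\in\delta_\alpha$. Then the prepotential $$F_{\mathcal{B}}(\xi,y)=\tfrac13y^3+\sum_{\alpha\in\mathcal{A}\setminus\mathcal{B}}c_\alpha\overline{\alpha}(\xi)^2y+\lambda\sum_{\alpha\in\mathcal{A}\setminus\mathcal{B}}c_\alpha f(\overline{\alpha}(\xi)),\qquad \xi\in W_{\mathcal{B}},\ y\in U,$$ satisfies the WDVV equations on $W_{\mathcal{B}}\oplus U$ (in particular the matrix $F_{n+1}$, $n=\dim W_{\mathcal{B}}$, is invertible). The corresponding multiplication $\ast$ on the tangent spaces $T_{(\xi,y)}(W_{\mathcal{B}}\oplus U)$ is associative, and for $u,v\in W_{\mathcal{B}}$ it has the form $$u\ast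 v=\sum_{\alpha\in\mathcal{A}\setminus\mathcal{B}}c_\alpha\overline{\alpha}(u)\overline{\alpha}(v)\Big(\frac{\lambda}{2}\cot\overline{\alpha}(\xi)\;\overline{\alpha}^{\vee_{W_{\mathcal{B}}}}+E\Big),\qquad E=\partial_y .$$ -/

import Mathlib

open Module

/-! ### The function `f` -/

/-- The trilogarithm `Li₃(w) = ∑_{n ≥ 1} wⁿ / n³`, given by its power series for `‖w‖ < 1`. -/
noncomputable def triLog (w : ℂ) : ℂ := ∑' n : ℕ, w ^ (n + 1) / ((n : ℂ) + 1) ^ 3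

/-- `f(z) = (i/6) z³ + (1/4) Li₃(e^{-2iz})`, used through this series only where `Im z < 0`,
that is where `‖e^{-2iz}‖ < 1`. -/
noncomputable def trigFun (z : ℂ) : ℂ :=
  Complex.I / 6 * z ^ 3 + 1 / 4 * triLog (Complex.exp (-2 * Complex.I * z))

/-- The multivalued function `f(z) = (i/6) z³ + (1/4) Li₃(e^{-2iz})`: `IsBranch g z` says that
the germ of `g` at `z` is a branch of `f`, i.e. is obtained from the germs of `trigFun` in the lower
half-plane by analytic continuation. -/
inductive IsBranch : (ℂ → ℂ) → ℂ → Prop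
  | base (z : ℂ) (hz : z.im < 0) : IsBranch trigFun z
  | continuation (g : ℂ → ℂ) (U : Set ℂ) (z w : ℂ) (hU : IsOpen U) (hc : IsPreconnected U)
      (hg : AnalyticOnNhd ℂ g U) (hz : z ∈ U) (hw : w ∈ U) (h : IsBranch g z) : IsBranch g w
  | congr (g h : ℂ → ℂ) (z : ℂ) (hgh : ∀ᶠ t in nhds z, g t = h t) (hg : IsBranch g z) :
      IsBranch h z

namespace TrigAux

/-- The series `∑ e^{-2i(n+1)z} / (n+1)^s`. -/
noncomputable def ser (s : ℕ) (z : ℂ) : ℂ :=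
  ∑' n : ℕ, Complex.exp (-2 * Complex.I * ((n : ℂ) + 1) * z) / ((n : ℂ) + 1) ^ s

lemma norm_term_le (s n : ℕ) (z : ℂ) (e : ℝ) (hz : z.im < -e) :
    ‖Complex.exp (-2 * Complex.I * ((n : ℂ) + 1) * z) / ((n : ℂ) + 1) ^ s‖
      ≤ Real.exp (-2 * e) ^ (n + 1) := by
  have h1 : ‖((n : ℂ) + 1) ^ s‖ = ((n : ℝ) + 1) ^ s := by
    rw [norm_pow]
    congr 1
    have : ((n : ℂ) + 1) = ((n + 1 : ℕ) : ℂ) := by push_cast; ring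
    rw [this, Complex.norm_natCast]
    push_cast; ring
  have h2 : (1 : ℝ) ≤ ((n : ℝ) + 1) ^ s := one_le_pow₀ (by linarith [Nat.cast_nonneg (α := ℝ) n])
  rw [norm_div, h1, Complex.norm_exp, ← Real.exp_nat_mul]
  refine (div_le_self (Real.exp_nonneg _) h2).trans (Real.exp_le_exp.2 ?_)
  have h3 : (-2 * Complex.I * ((n : ℂ) + 1) * z).re = 2 * ((n : ℝ) + 1) * z.im := by
    simp [Complex.mul_re, Complex.mul_im]
  rw [h3]
  push_cast
  nlinarith [Nat.cast_nonneg (α := ℝ) n]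

lemma summable_bound {e : ℝ} (he : 0 < e) :
    Summable fun n : ℕ => Real.exp (-2 * e) ^ (n + 1) := by
  have h : Real.exp (-2 * e) < 1 := (Real.exp_lt_exp.2 (by linarith)).trans_eq Real.exp_zero
  simpa [pow_succ] using (summable_geometric_of_lt_one (Real.exp_nonneg _) h).mul_right _

lemma isOpen_im (e : ℝ) : IsOpen {z : ℂ | z.im < e} :=
  isOpen_lt Complex.continuous_im continuous_const

lemma hasDerivAt_ser (s : ℕ) {z : ℂ} (hz : z.im < 0) :
    HasDerivAt (ser (s + 1)) (-2 * Complex.I * ser s z) z := by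
  obtain ⟨e, he, hze⟩ : ∃ e : ℝ, 0 < e ∧ z.im < -e := ⟨-z.im / 2, by linarith, by linarith⟩
  have hd : ∀ (n : ℕ) (w : ℂ), HasDerivAt
      (fun w => Complex.exp (-2 * Complex.I * ((n : ℂ) + 1) * w) / ((n : ℂ) + 1) ^ (s + 1))
      (-2 * Complex.I *
        (Complex.exp (-2 * Complex.I * ((n : ℂ) + 1) * w) / ((n : ℂ) + 1) ^ s)) w := by
    intro n w
    have h := ((((hasDerivAt_id w).const_mul (-2 * Complex.I * ((n : ℂ) + 1))).cexp).div_const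
      (((n : ℂ) + 1) ^ (s + 1)))
    have hn : ((n : ℂ) + 1) ≠ 0 := Nat.cast_add_one_ne_zero n
    refine h.congr_deriv ?_
    simp only [id]
    field_simp
    ring
  have hF : ∀ n : ℕ, DifferentiableOn ℂ
      (fun w => Complex.exp (-2 * Complex.I * ((n : ℂ) + 1) * w) / ((n : ℂ) + 1) ^ (s + 1))
      {w : ℂ | w.im < -e} :=
    fun n w _ => (hd n w).differentiableAt.differentiableWithinAt
  have hsum := Complex.hasSum_deriv_of_summable_norm (summable_bound he) hF (isOpen_im _)
    (fun n w hw => norm_term_le (s + 1) n w e hw) hze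
  have hdiff := (Complex.differentiableOn_tsum_of_summable_norm (summable_bound he) hF (isOpen_im _)
    (fun n w hw => norm_term_le (s + 1) n w e hw)).differentiableAt ((isOpen_im _).mem_nhds hze)
  refine hdiff.hasDerivAt.congr_deriv ?_
  rw [← hsum.tsum_eq, ser, ← tsum_mul_left]
  exact tsum_congr fun n => (hd n z).deriv

lemma triLog_exp (z : ℂ) : triLog (Complex.exp (-2 * Complex.I * z)) = ser 3 z := by
  refine tsum_congr fun n => ?_
  rw [← Complex.exp_nat_mul]
  congr 2
  push_cast
  ring

lemma sin_ne_zero_of_im_neg {z : ℂ} (hz : z.im < 0) : Complex.sin z ≠ 0 := by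
  intro h
  obtain ⟨k, hk⟩ := Complex.sin_eq_zero_iff.1 h
  rw [hk] at hz
  simp [Complex.mul_im] at hz

lemma ser_zero {z : ℂ} (hz : z.im < 0) :
    Complex.I + 2 * Complex.I * ser 0 z = Complex.cot z := by
  have hw : ‖Complex.exp (-2 * Complex.I * z)‖ < 1 := by
    rw [Complex.norm_exp]
    refine (Real.exp_lt_exp.2 ?_).trans_eq Real.exp_zero
    simp [Complex.mul_re]
    linarith
  have h1 : ser 0 z = Complex.exp (-2 * Complex.I * z) *
      (1 - Complex.exp (-2 * Complex.I * z))⁻¹ := by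
    rw [← tsum_geometric_of_norm_lt_one hw, ← tsum_mul_left]
    refine tsum_congr fun n => ?_
    rw [← pow_succ', ← Complex.exp_nat_mul]
    simp only [pow_zero, div_one]
    congr 1
    push_cast
    ring
  have h2 : (1 - Complex.exp (-2 * Complex.I * z)) ≠ 0 := by
    intro h
    rw [← sub_eq_zero.1 h] at hw
    simp at hw
  have h3 := sin_ne_zero_of_im_neg hz
  have h4 : Complex.exp (-2 * Complex.I * z) = Complex.exp (-z * Complex.I) ^ 2 := by
    rw [← Complex.exp_nat_mul]
    congr 1
    push_cast
    ring
  have h5 : Complex.exp (z * Complex.I) * Complex.exp (-z * Complex.I) = 1 := by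
    rw [← Complex.exp_add]
    simp
  rw [h1, Complex.cot, eq_div_iff h3, Complex.sin, Complex.cos]
  rw [h4] at h2 ⊢
  set p := Complex.exp (z * Complex.I)
  set q := Complex.exp (-z * Complex.I)
  have hI : Complex.I ^ 2 = -1 := Complex.I_sq
  field_simp
  rw [hI]
  linear_combination (2 * q) * h5

lemma hasDerivAt_trigFun {z : ℂ} (hz : z.im < 0) :
    HasDerivAt trigFun (Complex.I / 2 * z ^ 2 - Complex.I / 2 * ser 2 z) z := by
  have h : trigFun = fun z => Complex.I / 6 * z ^ 3 + 1 / 4 * ser 3 z := by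
    funext z
    rw [trigFun, triLog_exp]
  rw [h]
  refine (((hasDerivAt_pow 3 z).const_mul (Complex.I / 6)).add
    ((hasDerivAt_ser 2 hz).const_mul (1 / 4))).congr_deriv ?_
  push_cast
  ring

lemma hasDerivAt_trigFun' {z : ℂ} (hz : z.im < 0) :
    HasDerivAt (fun z => Complex.I / 2 * z ^ 2 - Complex.I / 2 * ser 2 z)
      (Complex.I * z - ser 1 z) z := by
  refine (((hasDerivAt_pow 2 z).const_mul (Complex.I / 2)).sub
    ((hasDerivAt_ser 1 hz).const_mul (Complex.I / 2))).congr_deriv ?_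
  push_cast
  linear_combination (ser 1 z) * Complex.I_sq

lemma hasDerivAt_trigFun'' {z : ℂ} (hz : z.im < 0) :
    HasDerivAt (fun z => Complex.I * z - ser 1 z) (Complex.cot z) z := by
  refine (((hasDerivAt_id z).const_mul Complex.I).sub (hasDerivAt_ser 0 hz)).congr_deriv ?_
  rw [← ser_zero hz]
  ring

lemma analyticAt_trigFun {z : ℂ} (hz : z.im < 0) : AnalyticAt ℂ trigFun z :=
  DifferentiableOn.analyticAt (s := {z : ℂ | z.im < 0})
    (fun _ hw => (hasDerivAt_trigFun hw).differentiableAt.differentiableWithinAt)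
    ((isOpen_im 0).mem_nhds hz)

lemma iteratedDeriv_trigFun {z : ℂ} (hz : z.im < 0) :
    iteratedDeriv 3 trigFun z = Complex.cot z := by
  have hO := (isOpen_im 0).mem_nhds hz
  have e1 : ∀ w : ℂ, w.im < 0 →
      deriv trigFun w = Complex.I / 2 * w ^ 2 - Complex.I / 2 * ser 2 w :=
    fun w hw => (hasDerivAt_trigFun hw).deriv
  have e2 : ∀ w : ℂ, w.im < 0 → deriv (deriv trigFun) w = Complex.I * w - ser 1 w := by
    intro w hw
    rw [Filter.EventuallyEq.deriv_eq (Filter.eventually_of_mem ((isOpen_im 0).mem_nhds hw) e1)]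
    exact (hasDerivAt_trigFun' hw).deriv
  rw [iteratedDeriv_succ, iteratedDeriv_succ, iteratedDeriv_one,
    Filter.EventuallyEq.deriv_eq (Filter.eventually_of_mem hO e2)]
  exact (hasDerivAt_trigFun'' hz).deriv

end TrigAux

/-- Every branch `g` of `f` is analytic and satisfies `g''' = cot`, and there are no branches
at the points of `πℤ`. -/
theorem IsBranch.spec {g : ℂ → ℂ} {z : ℂ} (h : IsBranch g z) :
    Complex.sin z ≠ 0 ∧ AnalyticAt ℂ g z ∧
      ∀ᶠ w in nhds z, iteratedDeriv 3 g w = Complex.cot w := by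
  induction h with
  | base z hz =>
    exact ⟨TrigAux.sin_ne_zero_of_im_neg hz, TrigAux.analyticAt_trigFun hz,
      Filter.eventually_of_mem ((TrigAux.isOpen_im 0).mem_nhds hz)
        fun w hw => TrigAux.iteratedDeriv_trigFun hw⟩
  | congr g h z hgh _ ih =>
    obtain ⟨h1, h2, h3⟩ := ih
    refine ⟨h1, h2.congr hgh, ?_⟩
    filter_upwards [h3, eventually_eventually_nhds.2 hgh] with w hw1 hw2
    rw [← hw1]
    exact (Filter.EventuallyEq.iteratedDeriv_eq 3 hw2).symm
  | continuation g U z w hU hc hg hz hw _ ih =>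
    obtain ⟨h1, h2, h3⟩ := ih
    have hsin : AnalyticOnNhd ℂ Complex.sin U :=
      fun t _ => Complex.differentiable_sin.analyticAt t
    have hcos : AnalyticOnNhd ℂ Complex.cos U :=
      fun t _ => Complex.differentiable_cos.analyticAt t
    have hg3 : AnalyticOnNhd ℂ (fun t => iteratedDeriv 3 g t * Complex.sin t) U :=
      by
      have := hg.iterated_deriv 3
      rw [← iteratedDeriv_eq_iterate] at this
      exact this.mul hsin
    have heq := hg3.eqOn_of_preconnected_of_eventuallyEq hcos hc hz (by
      filter_upwards [h3, Complex.continuous_sin.continuousAt.eventually_ne h1] with t ht1 ht2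
      rw [ht1, Complex.cot, div_mul_cancel₀ _ ht2])
    have hw0 : Complex.sin w ≠ 0 := by
      intro h0
      have hc0 : iteratedDeriv 3 g w * Complex.sin w = Complex.cos w := heq hw
      have := Complex.sin_sq_add_cos_sq w
      rw [← hc0, h0] at this
      simp at this
    refine ⟨hw0, hg w hw, ?_⟩
    filter_upwards [hU.mem_nhds hw, Complex.continuous_sin.continuousAt.eventually_ne hw0]
      with t ht1 ht2
    have hct : iteratedDeriv 3 g t * Complex.sin t = Complex.cos t := heq ht1
    rw [Complex.cot, eq_div_iff ht2, hct]

/-- `f` has a branch at every point outside `πℤ`. -/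
theorem exists_isBranch {z : ℂ} (hz : Complex.sin z ≠ 0) : ∃ g : ℂ → ℂ, IsBranch g z := by
  by_cases him : z.im < 0
  · exact ⟨trigFun, .base z him⟩
  have hs : 0 ≤ z.im := not_lt.1 him
  have hpi := Real.pi_gt_three
  obtain ⟨k, hk1, hk2⟩ : ∃ k : ℤ, (k : ℝ) * Real.pi ≤ z.re ∧ z.re < (k + 1) * Real.pi :=
    ⟨⌊z.re / Real.pi⌋, (le_div_iff₀ Real.pi_pos).1 (Int.floor_le _),
      (div_lt_iff₀ Real.pi_pos).1 (Int.lt_floor_add_one _)⟩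
  set T : ℝ := z.im + 1 with hT
  set c : ℂ := ⟨k * Real.pi + Real.pi / 2, T⟩ with hc
  set r : ℝ := Real.sqrt (Real.pi ^ 2 / 4 + T ^ 2) with hr
  have hmem : ∀ w : ℂ, w ∈ Metric.ball c r ↔
      (w.re - (k * Real.pi + Real.pi / 2)) ^ 2 + (w.im - T) ^ 2 < Real.pi ^ 2 / 4 + T ^ 2 := by
    intro w
    rw [mem_ball_iff_norm, hr, Real.lt_sqrt (norm_nonneg _), Complex.sq_norm, Complex.normSq_apply]
    simp [hc, pow_two]
  have hsin : ∀ w ∈ Metric.ball c r, Complex.sin w ≠ 0 := by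
    intro w hw h0
    obtain ⟨m, hm⟩ := Complex.sin_eq_zero_iff.1 h0
    have hre : w.re = m * Real.pi := by simp [hm]
    have him : w.im = 0 := by simp [hm]
    rw [hmem, hre, him] at hw
    have h1 : (0 : ℤ) ≤ (m - k) * (m - k - 1) := by
      rcases le_or_gt m k with h | h
      · exact mul_nonneg_of_nonpos_of_nonpos (by omega) (by omega)
      · exact mul_nonneg (by omega) (by omega)
    have h2 : (0 : ℝ) ≤ ((m : ℝ) - k) * (m - k - 1) := by exact_mod_cast h1
    nlinarith [mul_nonneg h2 (sq_nonneg Real.pi)]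
  have hz : z ∈ Metric.ball c r := by
    rw [hmem]
    rcases eq_or_lt_of_le hk1 with h | h
    · rcases eq_or_lt_of_le hs with h' | h'
      · exact absurd (Complex.sin_eq_zero_iff.2 ⟨k, by apply Complex.ext <;> simp [← h, ← h']⟩) hz
      · rw [← h, hT]
        nlinarith
    · rw [hT]
      nlinarith [mul_pos (sub_pos.2 h) (sub_pos.2 hk2)]
  set p : ℂ := ⟨k * Real.pi + Real.pi / 2, -(1 / (T + 1))⟩ with hp
  have hTpos : 0 < T + 1 := by rw [hT]; linarith
  have hpim : p.im < 0 := by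
    have : 0 < 1 / (T + 1) := by positivity
    simpa [hp] using this
  have hpb : p ∈ Metric.ball c r := by
    rw [hmem]
    have h1 : (1 / (T + 1)) * (T + 1) = 1 := by field_simp
    have h2 : 0 < 1 / (T + 1) := by positivity
    have h3 : 1 / (T + 1) ≤ 1 := by
      rw [div_le_one hTpos, hT]
      linarith
    simp only [hp]
    nlinarith
  have hcot : DifferentiableOn ℂ Complex.cot (Metric.ball c r) := fun w hw =>
    (Complex.differentiableAt_cos.div Complex.differentiableAt_sin
      (hsin w hw)).differentiableWithinAt
  have step : ∀ h h' H : ℂ → ℂ, (∀ w : ℂ, w.im < 0 → HasDerivAt h (h' w) w) →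
      DifferentiableOn ℂ H (Metric.ball c r) →
      (∀ w ∈ Metric.ball c r, w.im < 0 → H w = h' w) →
      ∃ G : ℂ → ℂ, DifferentiableOn ℂ G (Metric.ball c r) ∧
        ∀ w ∈ Metric.ball c r, w.im < 0 → G w = h w := by
    intro h h' H hh hH hHh
    obtain ⟨G, hG0, hG⟩ := hH.isExactOn_ball.with_val_at p (h p)
    refine ⟨G, fun w hw => (hG w hw).differentiableAt.differentiableWithinAt, fun w hw hw' => ?_⟩
    have hconv : Convex ℝ (Metric.ball c r ∩ {w : ℂ | w.im < 0}) :=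
      (convex_ball c r).inter (convex_halfSpace_im_lt 0)
    refine (Metric.isOpen_ball.inter (TrigAux.isOpen_im 0)).eqOn_of_deriv_eq hconv.isPreconnected
      (fun t ht => (hG t ht.1).differentiableAt.differentiableWithinAt)
      (fun t ht => (hh t ht.2).differentiableAt.differentiableWithinAt)
      (fun t ht => ?_) ⟨hpb, hpim⟩ hG0 ⟨hw, hw'⟩
    rw [(hG t ht.1).deriv, (hh t ht.2).deriv, hHh t ht.1 ht.2]
  obtain ⟨G2, hG2, hG2'⟩ := step _ _ _ (fun w hw => TrigAux.hasDerivAt_trigFun'' hw) hcot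
    (fun _ _ _ => rfl)
  obtain ⟨G1, hG1, hG1'⟩ := step _ _ _ (fun w hw => TrigAux.hasDerivAt_trigFun' hw) hG2 hG2'
  obtain ⟨G, hG, hG'⟩ := step _ _ _ (fun w hw => TrigAux.hasDerivAt_trigFun hw) hG1 hG1'
  refine ⟨G, .continuation G (Metric.ball c r) p z Metric.isOpen_ball
    (convex_ball c r).isPreconnected (hG.analyticOnNhd Metric.isOpen_ball) hpb hz
    (.congr trigFun G p ?_ (.base p hpim))⟩
  filter_upwards [Metric.isOpen_ball.mem_nhds hpb, (TrigAux.isOpen_im 0).mem_nhds hpim]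
    with w hw hw'
  exact (hG' w hw hw').symm

/-! ### WDVV equations and the multiplication on `V ⊕ U`, `U = ℂ` -/

section WDVV

variable {V : Type*} [AddCommGroup V] [Module ℂ V]

/-- Third order partial derivative `∂_u ∂_v ∂_w F` at the point `p`. -/
noncomputable def thirdPartial {E : Type*} [AddCommGroup E] [Module ℂ E]
    (F : E → ℂ) (u v w : E) (p : E) : ℂ :=
  lineDeriv ℂ (fun p₁ => lineDeriv ℂ (fun p₂ => lineDeriv ℂ F p₂ w) p₁ v) p u

/-- The basis `e₁, …, e_N, e_{N+1}` of `V ⊕ U` obtained from a basis `e₁, …, e_N` of `V`; the index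
`N + 1` is `Sum.inr ()`, and `e_{N+1}` is the vector `1` of `U = ℂ`. -/
noncomputable def extBasis {N : ℕ} (e : Basis (Fin N) ℂ V) :
    Basis (Fin N ⊕ Unit) ℂ (V × ℂ) :=
  e.prod (Basis.singleton Unit ℂ)

/-- The matrix `F_i` of third order partial derivatives of `F` at `p`. -/
noncomputable def wdvvMatrix {N : ℕ} (e : Basis (Fin N) ℂ V) (F : V × ℂ → ℂ) (p : V × ℂ)
    (i : Fin N ⊕ Unit) : Matrix (Fin N ⊕ Unit) (Fin N ⊕ Unit) ℂ :=
  Matrix.of fun r s => thirdPartial F (extBasis e i) (extBasis e r) (extBasis e s) p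

/-- The WDVV equations `F_i F_{N+1}⁻¹ F_j = F_j F_{N+1}⁻¹ F_i`, `i, j = 1, …, N`, at the
point `p`, with `F_{N+1}` invertible. -/
def WDVVAt {N : ℕ} (e : Basis (Fin N) ℂ V) (F : V × ℂ → ℂ) (p : V × ℂ) : Prop :=
  IsUnit (wdvvMatrix e F p (Sum.inr ())) ∧
  ∀ i j : Fin N,
    wdvvMatrix e F p (Sum.inl i) * (wdvvMatrix e F p (Sum.inr ()))⁻¹ *
        wdvvMatrix e F p (Sum.inl j) =
      wdvvMatrix e F p (Sum.inl j) * (wdvvMatrix e F p (Sum.inr ()))⁻¹ *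
        wdvvMatrix e F p (Sum.inl i)

/-- The multiplication `a ∗ b = a_i b_j η^{kl} F_{ijk} e_l` on the tangent space at `p`, where
`η^{kl}` are the entries of `F_{N+1}⁻¹`. -/
noncomputable def wdvvMul {N : ℕ} (e : Basis (Fin N) ℂ V) (F : V × ℂ → ℂ) (p : V × ℂ)
    (a b : V × ℂ) : V × ℂ :=
  ∑ i, ∑ j, ∑ k, ∑ l,
    ((extBasis e).repr a i * (extBasis e).repr b j *
      (wdvvMatrix e F p (Sum.inr ()))⁻¹ k l *
      thirdPartial F (extBasis e i) (extBasis e j) (extBasis e k) p) • extBasis e l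

/-- The prepotential `y³/3 + ∑_{i ∈ s} c_i γ_i(x)² y + λ ∑_{i ∈ s} c_i f(γ_i(x))` of a finite family
of covectors `γ_i` with multiplicities `c_i`. As `f` is multivalued, `g i` is the branch of `f` used
in the `i`-th term. -/
noncomputable def prepotential {I : Type*} (s : Finset I) (c : I → ℂ) (γ : I → Dual ℂ V)
    (lam : ℂ) (g : I → ℂ → ℂ) (p : V × ℂ) : ℂ :=
  1 / 3 * p.2 ^ 3 + (∑ i ∈ s, c i * γ i p.1 ^ 2) * p.2 + lam * ∑ i ∈ s, c i * g i (γ i p.1)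

/-- The prepotential of the family `γ_i`, `i ∈ s`, satisfies the WDVV equations: they hold at all
`(x, y)` at which it is regular, i.e. no `γ_i(x)` is in `πℤ`, and for every choice of the branches
of `f` near the points `γ_i(x)`. -/
def SatisfiesWDVV {N : ℕ} (e : Basis (Fin N) ℂ V) {I : Type*} (s : Finset I) (c : I → ℂ)
    (γ : I → Dual ℂ V) (lam : ℂ) : Prop :=
  ∀ (x : V) (y : ℂ), (∀ i ∈ s, Complex.sin (γ i x) ≠ 0) →
    ∀ g : I → ℂ → ℂ, (∀ i ∈ s, IsBranch (g i) (γ i x)) →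
      WDVVAt e (prepotential s c γ lam g) (x, y)

/-! ### Configurations of covectors -/

/-- `G_A(u, v) = ∑_{α ∈ A} c_α α(u) α(v)`. -/
noncomputable def formG (A : Finset (Dual ℂ V)) (c : Dual ℂ V → ℂ) : LinearMap.BilinForm ℂ V :=
  ∑ α ∈ A, c α • LinearMap.BilinForm.linMulLin α α

/-- `A` is contained in a lattice of rank `N` in the dual space. -/
def InLattice (A : Finset (Dual ℂ V)) (N : ℕ) : Prop :=
  ∃ L : Submodule ℤ (Dual ℂ V), L.FG ∧ finrank ℤ L = N ∧ ∀ α ∈ A, α ∈ L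

/-- `B = A ∩ W` for some linear subspace `W` of the dual space. -/
def IsSubsystem (A B : Finset (Dual ℂ V)) : Prop :=
  ∃ W : Submodule ℂ (Dual ℂ V), ∀ α, α ∈ B ↔ α ∈ A ∧ α ∈ W

/-- `S ⊆ B` is a basis of the linear span of `B`. -/
def IsSpanBasis (S B : Finset (Dual ℂ V)) : Prop :=
  S ⊆ B ∧ LinearIndependent ℂ (fun α : S => (α : Dual ℂ V)) ∧
    Submodule.span ℂ (S : Set (Dual ℂ V)) = Submodule.span ℂ (B : Set (Dual ℂ V))

open scoped Classical in
/-- `δ_α`, the set of the covectors in `A` collinear to `α`. -/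
noncomputable def collinearSet (A : Finset (Dual ℂ V)) (α : Dual ℂ V) : Finset (Dual ℂ V) :=
  A.filter fun γ => ∃ k : ℂ, γ = k • α

open scoped Classical in
/-- The number `k_γ` with `γ = k_γ α₀`, for `γ` proportional to `α₀ ≠ 0`. -/
noncomputable def ratio (γ α₀ : Dual ℂ V) : ℂ :=
  if h : ∃ k : ℂ, γ = k • α₀ then h.choose else 0

/-- `C_δ^{α₀} = ∑_{γ ∈ δ} c_γ k_γ²`. -/
noncomputable def collinearConst (δ : Finset (Dual ℂ V)) (c : Dual ℂ V → ℂ) (α₀ : Dual ℂ V) : ℂ :=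
  ∑ γ ∈ δ, c γ * ratio γ α₀ ^ 2

open scoped Classical in
/-- `A ∖ B`. -/
noncomputable def outside (A B : Finset (Dual ℂ V)) : Finset (Dual ℂ V) := A \ B

/-- `W_B`, the common kernel of the covectors in `B`. -/
def commonKer (B : Finset (Dual ℂ V)) : Submodule ℂ V := ⨅ β ∈ B, LinearMap.ker β

/-- `π_B(α)`, the restriction of `α` to `W_B`. -/
def restr (B : Finset (Dual ℂ V)) (α : Dual ℂ V) : Dual ℂ (commonKer B) :=
  α ∘ₗ (commonKer B).subtype

end WDVV

open Module

section Prepotential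

variable {V : Type*} [AddCommGroup V] [Module ℂ V]

/-- The bilinear form `∑_{i ∈ s} c_i γ_i(u) γ_i(v)`. -/
noncomputable def sumForm {I : Type*} (s : Finset I) (c : I → ℂ) (γ : I → Dual ℂ V) :
    LinearMap.BilinForm ℂ V :=
  ∑ i ∈ s, c i • LinearMap.BilinForm.linMulLin (γ i) (γ i)

lemma sumForm_apply {I : Type*} (s : Finset I) (c : I → ℂ) (γ : I → Dual ℂ V) (u v : V) :
    sumForm s c γ u v = ∑ i ∈ s, c i * (γ i u * γ i v) := by
  simp [sumForm]

lemma sumForm_comm {I : Type*} (s : Finset I) (c : I → ℂ) (γ : I → Dual ℂ V) (u v : V) :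
    sumForm s c γ u v = sumForm s c γ v u := by
  simp only [sumForm_apply, mul_comm]

/-- The trilinear form given by the third derivatives of the prepotential. -/
noncomputable def cubicForm {I : Type*} (s : Finset I) (c : I → ℂ) (γ : I → Dual ℂ V)
    (lam : ℂ) (x : V) (u v w : V × ℂ) : ℂ :=
  2 * (u.2 * v.2 * w.2) + 2 * (sumForm s c γ u.1 v.1 * w.2 + sumForm s c γ u.1 w.1 * v.2 +
    sumForm s c γ v.1 w.1 * u.2) +
    lam * ∑ i ∈ s, c i * (γ i u.1 * γ i v.1 * γ i w.1 * Complex.cot (γ i x))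

section Derivatives

variable {I : Type*} (s : Finset I) (c : I → ℂ) (γ : I → Dual ℂ V) (lam : ℂ) (g : I → ℂ → ℂ)

lemma hasDerivAt_comp_line {h : ℂ → ℂ} {h' : ℂ} (φ : Dual ℂ V) (x v : V)
    (hh : HasDerivAt h h' (φ x)) :
    HasDerivAt (fun t : ℂ => h (φ (x + t • v))) (h' * φ v) 0 := by
  have h1 : HasDerivAt (fun t : ℂ => φ (x + t • v)) (φ v) 0 := by
    simpa using ((hasDerivAt_id (0 : ℂ)).mul_const (φ v)).const_add (φ x)
  exact HasDerivAt.comp (0 : ℂ) (by simpa using hh) h1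

lemma hasDerivAt_line (φ : Dual ℂ V) (x v : V) :
    HasDerivAt (fun t : ℂ => φ (x + t • v)) (φ v) 0 := by
  simpa using hasDerivAt_comp_line φ x v (hasDerivAt_id (φ x))

lemma eventually_line {P : ℂ → Prop} (φ : Dual ℂ V) (x v : V) (h : ∀ᶠ z in nhds (φ x), P z) :
    ∀ᶠ t : ℂ in nhds 0, P (φ (x + t • v)) := by
  have h1 := (hasDerivAt_line φ x v).continuousAt
  rw [ContinuousAt, zero_smul, add_zero] at h1
  exact h1.eventually h

lemma lineDeriv_prepotential {p : V × ℂ} (w : V × ℂ)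
    (h : ∀ i ∈ s, AnalyticAt ℂ (g i) (γ i p.1)) :
    lineDeriv ℂ (prepotential s c γ lam g) p w =
      p.2 ^ 2 * w.2 + (∑ i ∈ s, c i * (2 * γ i p.1 * γ i w.1)) * p.2 +
        (∑ i ∈ s, c i * γ i p.1 ^ 2) * w.2 +
        lam * ∑ i ∈ s, c i * (deriv (g i) (γ i p.1) * γ i w.1) := by
  have hy : HasDerivAt (fun t : ℂ => p.2 + t * w.2) w.2 0 := by
    simpa using ((hasDerivAt_id (0 : ℂ)).mul_const w.2).const_add p.2
  have h1 : HasDerivAt (fun t : ℂ => ∑ i ∈ s, c i * γ i (p.1 + t • w.1) ^ 2)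
      (∑ i ∈ s, c i * (2 * γ i p.1 * γ i w.1)) 0 :=
    HasDerivAt.fun_sum fun i _ => by
      simpa using ((hasDerivAt_line (γ i) p.1 w.1).pow 2).const_mul (c i)
  have h2 : HasDerivAt (fun t : ℂ => ∑ i ∈ s, c i * g i (γ i (p.1 + t • w.1)))
      (∑ i ∈ s, c i * (deriv (g i) (γ i p.1) * γ i w.1)) 0 :=
    HasDerivAt.fun_sum fun i hi =>
      (hasDerivAt_comp_line (γ i) p.1 w.1 (h i hi).differentiableAt.hasDerivAt).const_mul (c i)
  refine HasLineDerivAt.lineDeriv (HasDerivAt.congr_deriv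
    (((hy.pow 3).const_mul (1 / 3)).add (h1.mul hy) |>.add (h2.const_mul lam)) ?_)
  simp
  ring

lemma lineDeriv_lineDeriv_prepotential {p : V × ℂ} (v w : V × ℂ)
    (h : ∀ i ∈ s, AnalyticAt ℂ (g i) (γ i p.1)) :
    lineDeriv ℂ (fun q => lineDeriv ℂ (prepotential s c γ lam g) q w) p v =
      2 * p.2 * v.2 * w.2 + (∑ i ∈ s, c i * (2 * γ i v.1 * γ i w.1)) * p.2 +
        (∑ i ∈ s, c i * (2 * γ i p.1 * γ i w.1)) * v.2 +
        (∑ i ∈ s, c i * (2 * γ i p.1 * γ i v.1)) * w.2 +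
        lam * ∑ i ∈ s, c i * (deriv (deriv (g i)) (γ i p.1) * γ i v.1 * γ i w.1) := by
  have hy : HasDerivAt (fun t : ℂ => p.2 + t * v.2) v.2 0 := by
    simpa using ((hasDerivAt_id (0 : ℂ)).mul_const v.2).const_add p.2
  have h1 : HasDerivAt (fun t : ℂ => ∑ i ∈ s, c i * γ i (p.1 + t • v.1) ^ 2)
      (∑ i ∈ s, c i * (2 * γ i p.1 * γ i v.1)) 0 :=
    HasDerivAt.fun_sum fun i _ => by
      simpa using ((hasDerivAt_line (γ i) p.1 v.1).pow 2).const_mul (c i)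
  have h3 : HasDerivAt (fun t : ℂ => ∑ i ∈ s, c i * (2 * γ i (p.1 + t • v.1) * γ i w.1))
      (∑ i ∈ s, c i * (2 * γ i v.1 * γ i w.1)) 0 :=
    HasDerivAt.fun_sum fun i _ =>
      (((hasDerivAt_line (γ i) p.1 v.1).const_mul 2).mul_const (γ i w.1)).const_mul (c i)
  have h2 : HasDerivAt (fun t : ℂ => ∑ i ∈ s, c i * (deriv (g i) (γ i (p.1 + t • v.1)) * γ i w.1))
      (∑ i ∈ s, c i * (deriv (deriv (g i)) (γ i p.1) * γ i v.1 * γ i w.1)) 0 :=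
    HasDerivAt.fun_sum fun i hi =>
      ((hasDerivAt_comp_line (γ i) p.1 v.1
        (h i hi).deriv.differentiableAt.hasDerivAt).mul_const (γ i w.1)).const_mul (c i)
  refine HasLineDerivAt.lineDeriv ?_
  have hev : ∀ᶠ t : ℂ in nhds 0, ∀ i ∈ s, AnalyticAt ℂ (g i) (γ i (p.1 + t • v.1)) :=
    (Filter.eventually_all_finset s).2 fun i hi =>
      eventually_line (γ i) p.1 v.1 (h i hi).eventually_analyticAt
  refine (HasDerivAt.congr_deriv (((((hy.pow 2).mul_const w.2).add (h3.mul hy)).add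
    (h1.mul_const w.2)).add (h2.const_mul lam)) ?_).congr_of_eventuallyEq ?_
  · simp
    ring
  · filter_upwards [hev] with t ht
    exact lineDeriv_prepotential s c γ lam g w ht

lemma thirdPartial_prepotential {p : V × ℂ} (u v w : V × ℂ)
    (h : ∀ i ∈ s, IsBranch (g i) (γ i p.1)) :
    thirdPartial (prepotential s c γ lam g) u v w p = cubicForm s c γ lam p.1 u v w := by
  have ha : ∀ i ∈ s, AnalyticAt ℂ (g i) (γ i p.1) := fun i hi => (h i hi).spec.2.1
  have hcot : ∀ i ∈ s, HasDerivAt (deriv (deriv (g i))) (Complex.cot (γ i p.1)) (γ i p.1) := by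
    intro i hi
    have h1 := (h i hi).spec.2.2.self_of_nhds
    rw [iteratedDeriv_succ, iteratedDeriv_succ, iteratedDeriv_one] at h1
    rw [← h1]
    exact (ha i hi).deriv.deriv.differentiableAt.hasDerivAt
  have hy : HasDerivAt (fun t : ℂ => p.2 + t * u.2) u.2 0 := by
    simpa using ((hasDerivAt_id (0 : ℂ)).mul_const u.2).const_add p.2
  have h3 : ∀ w : V × ℂ,
      HasDerivAt (fun t : ℂ => ∑ i ∈ s, c i * (2 * γ i (p.1 + t • u.1) * γ i w.1))
      (∑ i ∈ s, c i * (2 * γ i u.1 * γ i w.1)) 0 := fun w =>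
    HasDerivAt.fun_sum fun i _ =>
      (((hasDerivAt_line (γ i) p.1 u.1).const_mul 2).mul_const (γ i w.1)).const_mul (c i)
  have h2 : HasDerivAt
      (fun t : ℂ => ∑ i ∈ s, c i * (deriv (deriv (g i)) (γ i (p.1 + t • u.1)) * γ i v.1 * γ i w.1))
      (∑ i ∈ s, c i * (Complex.cot (γ i p.1) * γ i u.1 * γ i v.1 * γ i w.1)) 0 :=
    HasDerivAt.fun_sum fun i hi =>
      (((hasDerivAt_comp_line (γ i) p.1 u.1 (hcot i hi)).mul_const (γ i v.1)).mul_const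
        (γ i w.1)).const_mul (c i)
  refine HasLineDerivAt.lineDeriv ?_
  have hev : ∀ᶠ t : ℂ in nhds 0, ∀ i ∈ s, AnalyticAt ℂ (g i) (γ i (p.1 + t • u.1)) :=
    (Filter.eventually_all_finset s).2 fun i hi =>
      eventually_line (γ i) p.1 u.1 (ha i hi).eventually_analyticAt
  refine (HasDerivAt.congr_deriv ((((((hy.const_mul 2).mul_const v.2).mul_const w.2).add
    (hy.const_mul (∑ i ∈ s, c i * (2 * γ i v.1 * γ i w.1)))).add ((h3 w).mul_const v.2)).add
    ((h3 v).mul_const w.2) |>.add (h2.const_mul lam)) ?_).congr_of_eventuallyEq ?_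
  · have e : ∀ a b : V, ∑ i ∈ s, c i * (2 * γ i a * γ i b) = 2 * sumForm s c γ a b := by
      intro a b
      rw [sumForm_apply, Finset.mul_sum]
      exact Finset.sum_congr rfl fun i _ => by ring
    have e' : ∑ i ∈ s, c i * (Complex.cot (γ i p.1) * γ i u.1 * γ i v.1 * γ i w.1) =
        ∑ i ∈ s, c i * (γ i u.1 * γ i v.1 * γ i w.1 * Complex.cot (γ i p.1)) :=
      Finset.sum_congr rfl fun i _ => by ring
    rw [cubicForm, e, e, e, e']
    ring
  · filter_upwards [hev] with t ht
    refine (lineDeriv_lineDeriv_prepotential s c γ lam g v w ht).trans ?_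
    simp

end Derivatives

section Multiplication

variable {I : Type*} (s : Finset I) (c : I → ℂ) (γ : I → Dual ℂ V) (lam : ℂ) (d : I → V) (x : V)

/-- The vector `∑_{i ∈ s} c_i γ_i(u) γ_i(v) cot γ_i(x) d_i`; for `d_i` dual to `γ_i` this is,
up to the factor `λ / 2`, the component along `V` of the product of `u` and `v`. -/
noncomputable def cotVec (u v : V) : V :=
  ∑ i ∈ s, (c i * (γ i u * γ i v * Complex.cot (γ i x))) • d i

lemma cotVec_comm (u v : V) : cotVec s c γ d x u v = cotVec s c γ d x v u := by
  simp only [cotVec, mul_comm (γ _ u)]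

lemma cotVec_add (u v w : V) :
    cotVec s c γ d x u (v + w) = cotVec s c γ d x u v + cotVec s c γ d x u w := by
  simp only [cotVec, map_add, mul_add, add_mul, add_smul, Finset.sum_add_distrib]

lemma cotVec_smul (a : ℂ) (u v : V) :
    cotVec s c γ d x u (a • v) = a • cotVec s c γ d x u v := by
  simp only [cotVec, map_smul, Finset.smul_sum, smul_smul, smul_eq_mul]
  exact Finset.sum_congr rfl fun i _ => by congr 1; ring

/-- The multiplication on the tangent space in closed form. -/
noncomputable def tangentMul : (V × ℂ) →ₗ[ℂ] (V × ℂ) →ₗ[ℂ] V × ℂ :=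
  LinearMap.mk₂ ℂ
    (fun a b => (b.2 • a.1 + a.2 • b.1 + (lam / 2) • cotVec s c γ d x a.1 b.1,
      a.2 * b.2 + sumForm s c γ a.1 b.1))
    (fun a a' b => by
      ext
      · simp only [Prod.fst_add, Prod.snd_add, cotVec_comm s c γ d x _ b.1, cotVec_add]
        module
      · simp only [Prod.fst_add, Prod.snd_add, map_add, LinearMap.add_apply]
        ring)
    (fun k a b => by
      ext
      · simp only [Prod.smul_fst, Prod.smul_snd, cotVec_comm s c γ d x _ b.1, cotVec_smul,
          smul_eq_mul]
        module
      · simp only [Prod.smul_fst, Prod.smul_snd, map_smul, LinearMap.smul_apply, smul_eq_mul]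
        ring)
    (fun a b b' => by
      ext
      · simp only [Prod.fst_add, Prod.snd_add, cotVec_add]
        module
      · simp only [Prod.fst_add, Prod.snd_add, map_add]
        ring)
    (fun k a b => by
      ext
      · simp only [Prod.smul_fst, Prod.smul_snd, cotVec_smul, smul_eq_mul]
        module
      · simp only [Prod.smul_fst, Prod.smul_snd, map_smul, smul_eq_mul]
        ring)

lemma tangentMul_apply (a b : V × ℂ) :
    tangentMul s c γ lam d x a b =
      (b.2 • a.1 + a.2 • b.1 + (lam / 2) • cotVec s c γ d x a.1 b.1,
        a.2 * b.2 + sumForm s c γ a.1 b.1) := rfl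

lemma tangentMul_comm (a b : V × ℂ) :
    tangentMul s c γ lam d x a b = tangentMul s c γ lam d x b a := by
  rw [tangentMul_apply, tangentMul_apply, cotVec_comm, sumForm_comm, mul_comm, add_comm (b.2 • a.1)]

lemma tangentMul_unit (a : V × ℂ) : tangentMul s c γ lam d x (0, 1) a = a := by
  rw [tangentMul_apply]
  ext <;> simp [cotVec]

/-- The metric `2 (G ⊕ 1)` on `V ⊕ ℂ`. -/
noncomputable def metricForm : LinearMap.BilinForm ℂ (V × ℂ) :=
  LinearMap.mk₂ ℂ (fun a b => 2 * (a.2 * b.2) + 2 * sumForm s c γ a.1 b.1)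
    (fun a a' b => by
      simp only [Prod.fst_add, Prod.snd_add, map_add, LinearMap.add_apply]; ring)
    (fun k a b => by
      simp only [Prod.smul_fst, Prod.smul_snd, map_smul, LinearMap.smul_apply, smul_eq_mul]; ring)
    (fun a b b' => by simp only [Prod.fst_add, Prod.snd_add, map_add]; ring)
    (fun k a b => by simp only [Prod.smul_fst, Prod.smul_snd, map_smul, smul_eq_mul]; ring)

lemma metricForm_apply (a b : V × ℂ) :
    metricForm s c γ a b = 2 * (a.2 * b.2) + 2 * sumForm s c γ a.1 b.1 := rfl

lemma metricForm_comm (a b : V × ℂ) : metricForm s c γ a b = metricForm s c γ b a := by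
  rw [metricForm_apply, metricForm_apply, sumForm_comm, mul_comm a.2]

lemma metricForm_nondegenerate (hG : (sumForm s c γ).Nondegenerate) :
    (metricForm s c γ).Nondegenerate := by
  have h : (metricForm s c γ).SeparatingLeft := by
    intro a ha
    have h1 : a.2 = 0 := by simpa [metricForm_apply] using ha (0, 1)
    have h2 : a.1 = 0 := hG.1 _ fun v => by simpa [metricForm_apply] using ha (v, 0)
    exact Prod.ext h2 h1
  exact ⟨h, fun a ha => h a fun b => by rw [metricForm_comm]; exact ha b⟩

variable {s c γ d} in
lemma sumForm_cotVec (hd : ∀ i ∈ s, ∀ v, sumForm s c γ (d i) v = γ i v) (u v w : V) :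
    sumForm s c γ (cotVec s c γ d x u v) w =
      ∑ i ∈ s, c i * (γ i u * γ i v * γ i w * Complex.cot (γ i x)) := by
  rw [cotVec, map_sum, LinearMap.sum_apply]
  refine Finset.sum_congr rfl fun i hi => ?_
  rw [map_smul, LinearMap.smul_apply, hd i hi, smul_eq_mul]
  ring

variable {s c γ d} in
lemma metricForm_tangentMul (hd : ∀ i ∈ s, ∀ v, sumForm s c γ (d i) v = γ i v) (u v w : V × ℂ) :
    metricForm s c γ (tangentMul s c γ lam d x u v) w = cubicForm s c γ lam x u v w := by
  rw [metricForm_apply, tangentMul_apply, cubicForm]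
  simp only [map_add, LinearMap.add_apply, map_smul, LinearMap.smul_apply, smul_eq_mul,
    sumForm_cotVec x hd]
  ring

end Multiplication

section Matrices

variable {I : Type*} {s : Finset I} {c : I → ℂ} {γ : I → Dual ℂ V} {lam : ℂ} {d : I → V}
  {g : I → ℂ → ℂ} {p : V × ℂ} {N : ℕ} (e : Basis (Fin N) ℂ V)

lemma extBasis_inr : extBasis e (Sum.inr ()) = (0, 1) := by
  ext <;> simp [extBasis]

lemma wdvvMatrix_eq_mul (hd : ∀ i ∈ s, ∀ v, sumForm s c γ (d i) v = γ i v)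
    (hg : ∀ i ∈ s, IsBranch (g i) (γ i p.1)) (i : Fin N ⊕ Unit) :
    wdvvMatrix e (prepotential s c γ lam g) p i =
      LinearMap.BilinForm.toMatrix (extBasis e) (metricForm s c γ) *
        LinearMap.toMatrix (extBasis e) (extBasis e)
          (tangentMul s c γ lam d p.1 (extBasis e i)) := by
  ext r t
  rw [wdvvMatrix, Matrix.of_apply, thirdPartial_prepotential s c γ lam g _ _ _ hg,
    Matrix.mul_apply]
  simp only [LinearMap.BilinForm.toMatrix_apply, LinearMap.toMatrix_apply]
  have h : cubicForm s c γ lam p.1 (extBasis e i) (extBasis e r) (extBasis e t) =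
      metricForm s c γ (extBasis e r)
        (tangentMul s c γ lam d p.1 (extBasis e i) (extBasis e t)) := by
    rw [metricForm_comm, metricForm_tangentMul lam p.1 hd, cubicForm, cubicForm,
      sumForm_comm _ _ _ (extBasis e r).1]
    simp only [mul_right_comm]
    ring
  rw [h]
  conv_lhs =>
    rw [← (extBasis e).sum_repr (tangentMul s c γ lam d p.1 (extBasis e i) (extBasis e t))]
  rw [map_sum]
  exact Finset.sum_congr rfl fun k _ => by rw [map_smul, smul_eq_mul, mul_comm]

lemma wdvvMatrix_inr (hd : ∀ i ∈ s, ∀ v, sumForm s c γ (d i) v = γ i v)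
    (hg : ∀ i ∈ s, IsBranch (g i) (γ i p.1)) :
    wdvvMatrix e (prepotential s c γ lam g) p (Sum.inr ()) =
      LinearMap.BilinForm.toMatrix (extBasis e) (metricForm s c γ) := by
  have h : tangentMul s c γ lam d p.1 (0, 1) = LinearMap.id :=
    LinearMap.ext fun a => tangentMul_unit s c γ lam d p.1 a
  rw [wdvvMatrix_eq_mul e hd hg, extBasis_inr, h, LinearMap.toMatrix_id, mul_one]

lemma isUnit_metric (hG : (sumForm s c γ).Nondegenerate) :
    IsUnit (LinearMap.BilinForm.toMatrix (extBasis e) (metricForm s c γ)) := by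
  rw [Matrix.isUnit_iff_isUnit_det, isUnit_iff_ne_zero]
  exact (LinearMap.BilinForm.nondegenerate_iff_det_ne_zero _).1 (metricForm_nondegenerate s c γ hG)

lemma wdvvMatrix_mul_inv_mul (hG : (sumForm s c γ).Nondegenerate)
    (hd : ∀ i ∈ s, ∀ v, sumForm s c γ (d i) v = γ i v)
    (hg : ∀ i ∈ s, IsBranch (g i) (γ i p.1)) (i j : Fin N ⊕ Unit) :
    wdvvMatrix e (prepotential s c γ lam g) p i *
        (wdvvMatrix e (prepotential s c γ lam g) p (Sum.inr ()))⁻¹ *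
        wdvvMatrix e (prepotential s c γ lam g) p j =
      LinearMap.BilinForm.toMatrix (extBasis e) (metricForm s c γ) *
        LinearMap.toMatrix (extBasis e) (extBasis e)
          (tangentMul s c γ lam d p.1 (extBasis e i) *
            tangentMul s c γ lam d p.1 (extBasis e j)) := by
  rw [wdvvMatrix_inr e hd hg, wdvvMatrix_eq_mul e hd hg i, wdvvMatrix_eq_mul e hd hg j,
    LinearMap.toMatrix_mul, Matrix.mul_assoc, ← Matrix.mul_assoc _⁻¹,
    Matrix.nonsing_inv_mul _ ((Matrix.isUnit_iff_isUnit_det _).1 (isUnit_metric e hG)),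
    Matrix.one_mul, Matrix.mul_assoc]

lemma wdvvAt_iff (hG : (sumForm s c γ).Nondegenerate)
    (hd : ∀ i ∈ s, ∀ v, sumForm s c γ (d i) v = γ i v)
    (hg : ∀ i ∈ s, IsBranch (g i) (γ i p.1)) :
    WDVVAt e (prepotential s c γ lam g) p ↔
      ∀ a b : V × ℂ, Commute (tangentMul s c γ lam d p.1 a) (tangentMul s c γ lam d p.1 b) := by
  have hu := isUnit_metric e hG
  have key : ∀ i j : Fin N ⊕ Unit,
      wdvvMatrix e (prepotential s c γ lam g) p i *
        (wdvvMatrix e (prepotential s c γ lam g) p (Sum.inr ()))⁻¹ *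
        wdvvMatrix e (prepotential s c γ lam g) p j =
      wdvvMatrix e (prepotential s c γ lam g) p j *
        (wdvvMatrix e (prepotential s c γ lam g) p (Sum.inr ()))⁻¹ *
        wdvvMatrix e (prepotential s c γ lam g) p i ↔
      Commute (tangentMul s c γ lam d p.1 (extBasis e i))
        (tangentMul s c γ lam d p.1 (extBasis e j)) := by
    intro i j
    rw [wdvvMatrix_mul_inv_mul e hG hd hg, wdvvMatrix_mul_inv_mul e hG hd hg, hu.mul_right_inj,
      EmbeddingLike.apply_eq_iff_eq]
    rfl
  constructor
  · rintro ⟨-, h⟩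
    have hunit : tangentMul s c γ lam d p.1 (extBasis e (Sum.inr ())) = 1 :=
      LinearMap.ext fun a => by rw [extBasis_inr, tangentMul_unit]; rfl
    have hij : ∀ i j : Fin N ⊕ Unit, Commute (tangentMul s c γ lam d p.1 (extBasis e i))
        (tangentMul s c γ lam d p.1 (extBasis e j)) := by
      rintro (i | ⟨⟩) (j | ⟨⟩)
      · exact (key _ _).1 (h i j)
      all_goals rw [hunit]
      · exact Commute.one_right _
      · exact Commute.one_left _
    intro a b
    rw [← (extBasis e).sum_repr a, ← (extBasis e).sum_repr b, map_sum, map_sum]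
    refine Commute.sum_left _ _ _ fun i _ => Commute.sum_right _ _ _ fun j _ => ?_
    rw [map_smul, map_smul]
    exact ((hij i j).smul_left _).smul_right _
  · intro h
    exact ⟨by rw [wdvvMatrix_inr e hd hg]; exact hu, fun i j => (key _ _).2 (h _ _)⟩

lemma wdvvMul_eq_tangentMul (hG : (sumForm s c γ).Nondegenerate)
    (hd : ∀ i ∈ s, ∀ v, sumForm s c γ (d i) v = γ i v)
    (hg : ∀ i ∈ s, IsBranch (g i) (γ i p.1)) (a b : V × ℂ) :
    wdvvMul e (prepotential s c γ lam g) p a b = tangentMul s c γ lam d p.1 a b := by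
  set H := LinearMap.BilinForm.toMatrix (extBasis e) (metricForm s c γ) with hH
  have hu : IsUnit H.det := (Matrix.isUnit_iff_isUnit_det _).1 (isUnit_metric e hG)
  have h1 : ∀ i j, ∑ k, ∑ l, (H⁻¹ k l * thirdPartial (prepotential s c γ lam g)
      (extBasis e i) (extBasis e j) (extBasis e k) p) • extBasis e l =
      tangentMul s c γ lam d p.1 (extBasis e i) (extBasis e j) := by
    intro i j
    set m := tangentMul s c γ lam d p.1 (extBasis e i) (extBasis e j) with hm
    have h2 : ∀ k, thirdPartial (prepotential s c γ lam g)
        (extBasis e i) (extBasis e j) (extBasis e k) p =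
        ∑ q, (extBasis e).repr m q * H q k := by
      intro k
      rw [thirdPartial_prepotential s c γ lam g _ _ _ hg, ← metricForm_tangentMul lam p.1 hd,
        ← hm]
      conv_lhs => rw [← (extBasis e).sum_repr m]
      rw [map_sum, LinearMap.sum_apply]
      exact Finset.sum_congr rfl fun q _ => by
        rw [map_smul, LinearMap.smul_apply, smul_eq_mul, hH, LinearMap.BilinForm.toMatrix_apply]
    rw [Finset.sum_comm]
    conv_rhs => rw [← (extBasis e).sum_repr m]
    refine Finset.sum_congr rfl fun l _ => ?_
    rw [← Finset.sum_smul]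
    congr 1
    have h3 : Matrix.vecMul (Matrix.vecMul ((extBasis e).repr m) H) H⁻¹ l =
        (extBasis e).repr m l := by
      rw [Matrix.vecMul_vecMul, Matrix.mul_nonsing_inv _ hu, Matrix.vecMul_one]
    rw [← h3]
    exact Finset.sum_congr rfl fun k _ => by rw [h2, mul_comm]; rfl
  rw [wdvvMul, wdvvMatrix_inr e hd hg, ← hH]
  conv_rhs => rw [← (extBasis e).sum_repr a, ← (extBasis e).sum_repr b]
  simp only [map_sum, LinearMap.sum_apply, map_smul, LinearMap.smul_apply, ← h1,
    Finset.smul_sum, smul_smul]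
  refine (Finset.sum_comm).trans (Finset.sum_congr rfl fun j _ => Finset.sum_congr rfl fun i _ =>
    Finset.sum_congr rfl fun k _ => Finset.sum_congr rfl fun l _ => ?_)
  congr 1
  ring

end Matrices

end Prepotential

section Symmetry

variable {V : Type*} [AddCommGroup V] [Module ℂ V] {I : Type*} {s : Finset I} {c : I → ℂ}
  {γ : I → Dual ℂ V} {d : I → V}

/-- The products commute with each other, i.e. the multiplication is associative, exactly when
`G(v * w, u * z)` is symmetric in `u` and `v`. -/
lemma commute_tangentMul_iff (lam : ℂ) (x : V) (hG : (sumForm s c γ).Nondegenerate)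
    (hd : ∀ i ∈ s, ∀ v, sumForm s c γ (d i) v = γ i v) :
    (∀ a b : V × ℂ, Commute (tangentMul s c γ lam d x a) (tangentMul s c γ lam d x b)) ↔
      ∀ u v w z : V, sumForm s c γ v w * sumForm s c γ u z +
          lam ^ 2 / 4 * sumForm s c γ (cotVec s c γ d x u z) (cotVec s c γ d x v w) =
        sumForm s c γ u w * sumForm s c γ v z +
          lam ^ 2 / 4 * sumForm s c γ (cotVec s c γ d x v z) (cotVec s c γ d x u w) := by
  have adj : ∀ a m z : V × ℂ, metricForm s c γ (tangentMul s c γ lam d x a m) z =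
      metricForm s c γ m (tangentMul s c γ lam d x a z) := by
    intro a m z
    rw [metricForm_comm s c γ m, metricForm_tangentMul lam x hd, metricForm_tangentMul lam x hd,
      cubicForm, cubicForm, sumForm_comm _ _ _ m.1]
    simp only [mul_right_comm]
    ring
  have expand : ∀ (u v : V) (w z : V × ℂ),
      metricForm s c γ (tangentMul s c γ lam d x (v, 0) w) (tangentMul s c γ lam d x (u, 0) z) =
        2 * (sumForm s c γ v w.1 * sumForm s c γ u z.1 +
          lam ^ 2 / 4 * sumForm s c γ (cotVec s c γ d x u z.1) (cotVec s c γ d x v w.1)) +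
        2 * (w.2 * z.2) * sumForm s c γ u v +
        lam * w.2 * sumForm s c γ (cotVec s c γ d x u z.1) v +
        lam * z.2 * sumForm s c γ (cotVec s c γ d x v w.1) u := by
    intro u v w z
    rw [sumForm_comm s c γ (cotVec s c γ d x u z.1), sumForm_comm s c γ (cotVec s c γ d x u z.1),
      sumForm_comm s c γ u v]
    simp only [metricForm_apply, tangentMul_apply, map_add, LinearMap.add_apply, map_smul,
      LinearMap.smul_apply, smul_eq_mul, zero_smul, add_zero, zero_mul, zero_add]
    ring
  constructor
  · intro h u v w z
    have h1 := congrArg (fun m => metricForm s c γ m (z, 0))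
      (LinearMap.congr_fun (h (u, 0) (v, 0)).eq (w, 0))
    simp only [Module.End.mul_apply, adj _ (tangentMul s c γ lam d x _ _), expand] at h1
    linear_combination h1 / 2
  · intro h
    have hcub : ∀ u v w : V, sumForm s c γ (cotVec s c γ d x u v) w =
        sumForm s c γ (cotVec s c γ d x w v) u := by
      intro u v w
      rw [sumForm_cotVec x hd, sumForm_cotVec x hd]
      exact Finset.sum_congr rfl fun i _ => by ring
    have horiz : ∀ u v : V, Commute (tangentMul s c γ lam d x (u, 0))
        (tangentMul s c γ lam d x (v, 0)) := by
      intro u v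
      refine LinearMap.ext fun w => ?_
      rw [Module.End.mul_apply, Module.End.mul_apply]
      refine sub_eq_zero.1 ((metricForm_nondegenerate s c γ hG).1 _ fun z => ?_)
      rw [map_sub, LinearMap.sub_apply, adj (u, 0) (tangentMul s c γ lam d x _ _),
        adj (v, 0) (tangentMul s c γ lam d x _ _), expand, expand]
      linear_combination 2 * h u v w.1 z.1 + 2 * (w.2 * z.2) * sumForm_comm s c γ u v +
        lam * w.2 * hcub u z.1 v + lam * z.2 * hcub v w.1 u
    have split : ∀ a : V × ℂ, tangentMul s c γ lam d x a =
        tangentMul s c γ lam d x (a.1, 0) + a.2 • 1 := by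
      intro a
      have hunit : tangentMul s c γ lam d x (0, 1) = 1 :=
        LinearMap.ext fun b => tangentMul_unit s c γ lam d x b
      rw [← hunit, ← map_smul, ← map_add]
      congr 1
      ext <;> simp
    intro a b
    rw [split a, split b]
    exact ((horiz _ _).add_right ((Commute.one_right _).smul_right _)).add_left
      ((Commute.one_left _).smul_left _)

end Symmetry

section Limits

variable {V : Type*} [AddCommGroup V] [Module ℂ V] {I : Type*} {s : Finset I} {c : I → ℂ}
  {γ : I → Dual ℂ V} {d : I → V}

open Filter Topology

lemma eventually_sin_ne_zero {a b : ℂ} (h : Complex.sin a ≠ 0 ∨ b ≠ 0) :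
    ∀ᶠ t : ℂ in 𝓝[≠] 0, Complex.sin (a + t * b) ≠ 0 := by
  have h1 : HasDerivAt (fun t : ℂ => a + t * b) b 0 := by
    simpa using ((hasDerivAt_id (0 : ℂ)).mul_const b).const_add a
  have h2 : HasDerivAt (fun t : ℂ => Complex.sin (a + t * b)) (Complex.cos a * b) 0 := by
    simpa using h1.csin
  by_cases ha : Complex.sin a = 0
  · refine h2.eventually_ne (mul_ne_zero (fun h0 => ?_) (h.resolve_left fun h' => h' ha))
    have h3 := Complex.sin_sq_add_cos_sq a
    simp [ha, h0] at h3
  · have h3 : Tendsto (fun t : ℂ => Complex.sin (a + t * b)) (𝓝 0) (𝓝 (Complex.sin a)) := by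
      simpa using h2.continuousAt.tendsto
    exact (h3.eventually_ne ha).filter_mono nhdsWithin_le_nhds

lemma tendsto_cot_line {a : ℂ} (b : ℂ) (h : Complex.sin a ≠ 0) :
    Tendsto (fun t : ℂ => Complex.cot (a + t * b)) (𝓝[≠] 0) (𝓝 (Complex.cot a)) := by
  have h1 : ContinuousAt (fun t : ℂ => Complex.cos (a + t * b) / Complex.sin (a + t * b)) 0 :=
    ContinuousAt.div (by fun_prop) (by fun_prop) (by simpa using h)
  simpa [ContinuousAt, Complex.cot] using h1.tendsto.mono_left nhdsWithin_le_nhds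

lemma tendsto_mul_cot {b : ℂ} (hb : b ≠ 0) :
    Tendsto (fun t : ℂ => t * Complex.cot (t * b)) (𝓝[≠] 0) (𝓝 b⁻¹) := by
  have h1 : HasDerivAt (fun t : ℂ => Complex.sin (t * b)) b 0 := by
    simpa using ((hasDerivAt_id (0 : ℂ)).mul_const b).csin
  have h2 : Tendsto (fun t : ℂ => (t⁻¹ * Complex.sin (t * b))⁻¹) (𝓝[≠] 0) (𝓝 b⁻¹) := by
    have := hasDerivAt_iff_tendsto_slope_zero.1 h1
    simp only [zero_add, zero_mul, Complex.sin_zero, sub_zero, smul_eq_mul] at this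
    exact this.inv₀ hb
  have h3 : Tendsto (fun t : ℂ => Complex.cos (t * b)) (𝓝[≠] 0) (𝓝 1) := by
    have : ContinuousAt (fun t : ℂ => Complex.cos (t * b)) 0 := by fun_prop
    simpa [ContinuousAt] using this.tendsto.mono_left nhdsWithin_le_nhds
  refine ((h3.mul h2).congr fun t => ?_).trans_eq (by rw [one_mul])
  rw [Complex.cot, mul_inv, inv_inv]
  ring

lemma tendsto_dual_cotVec {x : V} (hx : ∀ i ∈ s, Complex.sin (γ i x) ≠ 0) (h : V) (φ : Dual ℂ V)
    (u v : V) :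
    Tendsto (fun t : ℂ => φ (cotVec s c γ d (x + t • h) u v)) (𝓝[≠] 0)
      (𝓝 (φ (cotVec s c γ d x u v))) := by
  simp only [cotVec, map_sum, map_smul, smul_eq_mul, map_add]
  exact tendsto_finsetSum _ fun i hi =>
    (((tendsto_cot_line (γ i h) (hx i hi)).const_mul _).const_mul _).mul_const _

lemma tendsto_sumForm_cotVec {G : LinearMap.BilinForm ℂ V} {x : V}
    (hx : ∀ i ∈ s, Complex.sin (γ i x) ≠ 0) (h u v w z : V) :
    Tendsto (fun t : ℂ => G (cotVec s c γ d (x + t • h) u v) (cotVec s c γ d (x + t • h) w z))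
      (𝓝[≠] 0) (𝓝 (G (cotVec s c γ d x u v) (cotVec s c γ d x w z))) := by
  have e : ∀ y : V, G (cotVec s c γ d y u v) (cotVec s c γ d y w z) =
      ∑ i ∈ s, c i * (γ i u * γ i v * Complex.cot (γ i y)) * G (d i) (cotVec s c γ d y w z) := by
    intro y
    conv_lhs => rw [cotVec]
    simp only [map_sum, LinearMap.sum_apply, map_smul, LinearMap.smul_apply, smul_eq_mul]
  simp only [e]
  refine tendsto_finsetSum _ fun i hi => ?_
  simp only [map_add, map_smul, smul_eq_mul]
  exact (((tendsto_cot_line (γ i h) (hx i hi)).const_mul _).const_mul _).mul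
    (tendsto_dual_cotVec hx h (G (d i)) w z)

lemma cotVec_subset {s' : Finset I} (hs : s' ⊆ s) {u : V} (hu : ∀ i ∈ s, i ∉ s' → γ i u = 0)
    (x v : V) : cotVec s c γ d x u v = cotVec s' c γ d x u v := by
  refine (Finset.sum_subset hs fun i hi hi' => ?_).symm
  rw [hu i hi hi']
  simp

end Limits

section Restriction

variable {V : Type*} [AddCommGroup V] [Module ℂ V]

open Filter Topology

lemma mem_outside {A B : Finset (Dual ℂ V)} {α : Dual ℂ V} :
    α ∈ outside A B ↔ α ∈ A ∧ α ∉ B := by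
  simp [outside]

lemma outside_subset (A B : Finset (Dual ℂ V)) : outside A B ⊆ A :=
  fun _ h => (mem_outside.1 h).1

lemma mem_commonKer {B : Finset (Dual ℂ V)} {v : V} :
    v ∈ commonKer B ↔ ∀ β ∈ B, β v = 0 := by
  simp [commonKer]

lemma mem_commonKer_of_isSpanBasis {S B : Finset (Dual ℂ V)} (hS : IsSpanBasis S B) {v : V}
    (h : ∀ β ∈ S, β v = 0) : v ∈ commonKer B := by
  have h1 : Submodule.span ℂ (S : Set (Dual ℂ V)) ≤ LinearMap.ker (Dual.eval ℂ V v) :=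
    Submodule.span_le.2 fun β hβ => h β hβ
  exact mem_commonKer.2 fun β hβ => h1 (hS.2.2 ▸ Submodule.subset_span hβ)

lemma mem_collinearSet {A : Finset (Dual ℂ V)} {α γ : Dual ℂ V} :
    γ ∈ collinearSet A α ↔ γ ∈ A ∧ ∃ k : ℂ, γ = k • α := by
  simp [collinearSet]

lemma eq_ratio_smul {A : Finset (Dual ℂ V)} {α γ : Dual ℂ V} (h : γ ∈ collinearSet A α) :
    γ = ratio γ α • α := by
  have h1 := (mem_collinearSet.1 h).2
  rw [ratio, dif_pos h1]
  exact h1.choose_spec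

variable {A : Finset (Dual ℂ V)} {c : Dual ℂ V → ℂ} {d : Dual ℂ V → V} {lam : ℂ}

lemma formG_eq_sumForm (A : Finset (Dual ℂ V)) (c : Dual ℂ V → ℂ) :
    formG A c = sumForm A c id := rfl

lemma symm_of_satisfiesWDVV {N : ℕ} (e : Basis (Fin N) ℂ V) (hG : (formG A c).Nondegenerate)
    (hF : SatisfiesWDVV e A c id lam) (hd : ∀ α ∈ A, ∀ v, formG A c (d α) v = α v)
    {x : V} (hx : ∀ α ∈ A, Complex.sin (α x) ≠ 0) (u v w z : V) :
    formG A c v w * formG A c u z +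
        lam ^ 2 / 4 * formG A c (cotVec A c id d x u z) (cotVec A c id d x v w) =
      formG A c u w * formG A c v z +
        lam ^ 2 / 4 * formG A c (cotVec A c id d x v z) (cotVec A c id d x u w) := by
  rw [formG_eq_sumForm] at *
  choose! g hg using fun α hα => exists_isBranch (hx α hα)
  have h1 : WDVVAt e (prepotential A c id lam g) (x, 0) := hF x 0 hx g hg
  exact (commute_tangentMul_iff lam x hG hd).1
    ((wdvvAt_iff (p := (x, 0)) e hG hd hg).1 h1) u v w z

open scoped Classical in
/-- The residue of the associativity relation along the mirror `β = 0`, at a generic point. -/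
lemma apply_cotVec_eq_zero_of_generic {N : ℕ} (e : Basis (Fin N) ℂ V) (hlam : lam ≠ 0)
    (hA : 0 ∉ A) (hG : (formG A c).Nondegenerate)
    (hF : SatisfiesWDVV e A c id lam) (hd : ∀ α ∈ A, ∀ v, formG A c (d α) v = α v)
    {β : Dual ℂ V} (hβ : β ≠ 0) (hC : collinearConst (collinearSet A β) c β ≠ 0)
    {x : V} (hxβ : β x = 0)
    (hx : ∀ α ∈ outside A (collinearSet A β), Complex.sin (α x) ≠ 0)
    {v z : V} (hv : β v = 0) (hz : β z = 0) :
    β (cotVec (outside A (collinearSet A β)) c id d x v z) = 0 := by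
  set T := outside A (collinearSet A β) with hT
  obtain ⟨b, hb⟩ : ∃ b, β b = 1 := by
    obtain ⟨b, hb⟩ := DFunLike.ne_iff.1 hβ
    exact ⟨(β b)⁻¹ • b, by simpa using inv_mul_cancel₀ hb⟩
  have hcol : ∀ α ∈ A, α ∉ T → α = α b • β ∧ α b ≠ 0 := by
    intro α hα hαT
    have h1 : α ∈ collinearSet A β := by
      by_contra h
      exact hαT (mem_outside.2 ⟨hα, h⟩)
    obtain ⟨k, hk⟩ := (mem_collinearSet.1 h1).2
    have h2 : α b = k := by rw [hk]; simp [hb]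
    rw [h2]
    refine ⟨hk, fun h0 => hA ?_⟩
    rwa [hk, h0, zero_smul] at hα
  have hvan : ∀ u : V, β u = 0 → ∀ α ∈ A, α ∉ T → (id α : Dual ℂ V) u = 0 := by
    intro u hu α hα hαT
    rw [id, (hcol α hα hαT).1, LinearMap.smul_apply, hu, smul_zero]
  have hsub : T ⊆ A := outside_subset _ _
  have hred : ∀ y u u', β u = 0 → cotVec A c id d y u u' = cotVec T c id d y u u' :=
    fun y u u' hu => cotVec_subset hsub (hvan u hu) y u'
  have hgen : ∀ᶠ t : ℂ in 𝓝[≠] 0, ∀ α ∈ A, Complex.sin (α (x + t • b)) ≠ 0 := by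
    refine (eventually_all_finset A).2 fun α hα => ?_
    simp only [map_add, map_smul, smul_eq_mul]
    refine eventually_sin_ne_zero ?_
    by_cases hαT : α ∈ T
    · exact Or.inl (hx α hαT)
    · exact Or.inr (hcol α hα hαT).2
  have hx' : ∀ α ∈ T, Complex.sin ((id α : Dual ℂ V) x) ≠ 0 := hx
  set P : V → V := fun y => cotVec T c id d y v z with hP
  -- The terms with a pole at `t = 0`.
  have hpole : Tendsto (fun t : ℂ => t * formG A c (P (x + t • b)) (cotVec A c id d (x + t • b) b b))
      (𝓝[≠] 0) (𝓝 (∑ α ∈ A, if α ∈ T then 0 else c α * (α b) ^ 2 * β (P x))) := by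
    have h1 : ∀ t : ℂ, t * formG A c (P (x + t • b)) (cotVec A c id d (x + t • b) b b) =
        ∑ α ∈ A, c α * (α b * α b) * (t * Complex.cot (α x + t * α b)) * α (P (x + t • b)) := by
      intro t
      have h2 := sumForm_cotVec (s := A) (c := c) (γ := id) (x + t • b) hd b b (P (x + t • b))
      have h3 := sumForm_comm A c id (P (x + t • b)) (cotVec A c id d (x + t • b) b b)
      change formG A c (P (x + t • b)) _ = _ at h3
      rw [h3, h2, Finset.mul_sum]
      refine Finset.sum_congr rfl fun α _ => ?_
      simp only [id, map_add, map_smul, smul_eq_mul]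
      ring
    simp only [h1]
    refine tendsto_finsetSum _ fun α hα => ?_
    have h4 := tendsto_dual_cotVec (s := T) (c := c) (γ := id) (d := d) hx' b α v z
    by_cases hαT : α ∈ T
    · rw [if_pos hαT]
      have h5 : Tendsto (fun t : ℂ => t * Complex.cot (α x + t * α b)) (𝓝[≠] 0) (𝓝 0) := by
        simpa using (tendsto_id.mono_left nhdsWithin_le_nhds : Tendsto id (𝓝[≠] (0 : ℂ)) _).mul
          (tendsto_cot_line (α b) (hx α hαT))
      simpa using (h5.const_mul (c α * (α b * α b))).mul h4
    · rw [if_neg hαT]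
      obtain ⟨h6, h7⟩ := hcol α hα hαT
      have h8 : α x = 0 := hvan x hxβ α hα hαT
      have h9 : α (P x) = α b * β (P x) := by
        conv_lhs => rw [h6]
        simp
      rw [h8]
      simp only [zero_add]
      refine (((tendsto_mul_cot h7).const_mul _).mul h4).trans_eq ?_
      change 𝓝 (_ * α (P x)) = _
      rw [h9]
      congr 1
      field_simp
  -- The terms regular at `t = 0`.
  have hreg : Tendsto (fun t : ℂ => t * (formG A c v b * formG A c b z +
      lam ^ 2 / 4 * formG A c (cotVec A c id d (x + t • b) b z)
        (cotVec A c id d (x + t • b) v b) - formG A c b b * formG A c v z)) (𝓝[≠] 0) (𝓝 0) := by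
    have h1 := tendsto_sumForm_cotVec (s := T) (c := c) (γ := id) (d := d) (G := formG A c)
      hx' b z b v b
    have h2 := (tendsto_id.mono_left nhdsWithin_le_nhds : Tendsto id (𝓝[≠] (0 : ℂ)) _).mul
      (((h1.const_mul (lam ^ 2 / 4)).const_add (formG A c v b * formG A c b z)).sub_const
        (formG A c b b * formG A c v z))
    rw [zero_mul] at h2
    refine h2.congr fun t => ?_
    rw [cotVec_comm A c id d _ b z, hred _ z b hz, hred _ v b hv]
    rfl
  have hlim := tendsto_nhds_unique (hreg.congr' (f₂ := fun t : ℂ => lam ^ 2 / 4 *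
      (t * formG A c (P (x + t • b)) (cotVec A c id d (x + t • b) b b))) (by
    filter_upwards [hgen] with t ht
    have h := symm_of_satisfiesWDVV e hG hF hd ht b v b z
    rw [hred _ v z hv] at h
    linear_combination t * h)) (hpole.const_mul _)
  have hsum : (∑ α ∈ A, if α ∈ T then 0 else c α * (α b) ^ 2 * β (P x)) =
      collinearConst (collinearSet A β) c β * β (P x) := by
    have h1 : ∀ α ∈ collinearSet A β, c α * ratio α β ^ 2 * β (P x) =
        if α ∈ T then 0 else c α * (α b) ^ 2 * β (P x) := by
      intro α hα
      have h2 : α b = ratio α β := by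
        conv_lhs => rw [eq_ratio_smul hα]
        simp [hb]
      rw [if_neg fun h => (mem_outside.1 h).2 hα, h2]
    rw [collinearConst, Finset.sum_mul, Finset.sum_congr rfl h1]
    refine (Finset.sum_subset (fun α hα => (mem_collinearSet.1 hα).1) fun α hα hα' => ?_).symm
    rw [if_pos (mem_outside.2 ⟨hα, hα'⟩)]
  rw [hsum] at hlim
  have hl : lam ^ 2 / 4 ≠ 0 := div_ne_zero (pow_ne_zero 2 hlam) (by norm_num)
  exact ((mul_eq_zero.1 ((mul_eq_zero.1 hlim.symm).resolve_left hl)).resolve_left hC)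

lemma cotVec_mem_commonKer {N : ℕ} (e : Basis (Fin N) ℂ V) (hlam : lam ≠ 0)
    (hA : 0 ∉ A) (hG : (formG A c).Nondegenerate)
    (hF : SatisfiesWDVV e A c id lam) (hd : ∀ α ∈ A, ∀ v, formG A c (d α) v = α v)
    {B S : Finset (Dual ℂ V)} (hB : IsSubsystem A B) (hS : IsSpanBasis S B)
    (hC : ∀ α ∈ S, ∀ α₀ ∈ collinearSet A α, collinearConst (collinearSet A α) c α₀ ≠ 0)
    {ξ : V} (hξB : ξ ∈ commonKer B) (hξ : ∀ α ∈ outside A B, Complex.sin (α ξ) ≠ 0)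
    {v z : V} (hv : v ∈ commonKer B) (hz : z ∈ commonKer B) :
    cotVec (outside A B) c id d ξ v z ∈ commonKer B := by
  obtain ⟨W, hW⟩ := hB
  refine mem_commonKer_of_isSpanBasis hS fun β hβ => ?_
  have hβB : β ∈ B := hS.1 hβ
  have hβA : β ∈ A := ((hW β).1 hβB).1
  have hβ0 : β ≠ 0 := fun h => hA (h ▸ hβA)
  have hCβ := hC β hβ β (mem_collinearSet.2 ⟨hβA, 1, (one_smul _ _).symm⟩)
  set T := outside A (collinearSet A β) with hT
  have hsub : outside A B ⊆ T := by
    intro α hα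
    obtain ⟨h1, h2⟩ := mem_outside.1 hα
    refine mem_outside.2 ⟨h1, fun h3 => h2 ((hW α).2 ⟨h1, ?_⟩)⟩
    obtain ⟨k, hk⟩ := (mem_collinearSet.1 h3).2
    rw [hk]
    exact W.smul_mem k ((hW β).1 hβB).2
  obtain ⟨b, hb⟩ := DFunLike.ne_iff.1 hβ0
  obtain ⟨h, hhβ, hh⟩ := Dual.exists_forall_mem_ne_zero_of_forall_exists (LinearMap.ker β)
    (fun α : T => (α : Dual ℂ V)) (by
      rintro ⟨α, hα⟩
      obtain ⟨h1, h2⟩ := mem_outside.1 hα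
      by_contra! h3
      refine h2 (mem_collinearSet.2 ⟨h1, α b / β b, LinearMap.ext fun y => ?_⟩)
      have h4 := h3 (y - (β y / β b) • b) (by simp [div_mul_cancel₀ _ hb])
      rw [map_sub, map_smul, sub_eq_zero, smul_eq_mul] at h4
      rw [h4, LinearMap.smul_apply, smul_eq_mul]
      ring)
  have hker := mem_commonKer.1 hv
  have hlim := tendsto_dual_cotVec (s := outside A B) (c := c) (γ := id) (d := d)
    (x := ξ) hξ h β v z
  refine tendsto_nhds_unique hlim (tendsto_const_nhds.congr' ?_)
  have hgen : ∀ᶠ t : ℂ in 𝓝[≠] 0, ∀ α ∈ T, Complex.sin (α (ξ + t • h)) ≠ 0 := by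
    refine (eventually_all_finset T).2 fun α hα => ?_
    simp only [map_add, map_smul, smul_eq_mul]
    exact eventually_sin_ne_zero (Or.inr (hh ⟨α, hα⟩))
  filter_upwards [hgen] with t ht
  rw [← apply_cotVec_eq_zero_of_generic e hlam hA hG hF hd hβ0 hCβ (x := ξ + t • h)
    (by rw [map_add, map_smul, mem_commonKer.1 hξB β hβB, LinearMap.mem_ker.1 hhβ]; simp) ht
    (hker β hβB) (mem_commonKer.1 hz β hβB)]
  rw [cotVec_subset hsub fun α hα hα' => ?_]
  by_contra h0
  exact hα' (mem_outside.2 ⟨(mem_outside.1 hα).1, fun hαB => h0 (hker α hαB)⟩)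

lemma symm_on_commonKer {N : ℕ} (e : Basis (Fin N) ℂ V)
    (hA : 0 ∉ A) (hG : (formG A c).Nondegenerate)
    (hF : SatisfiesWDVV e A c id lam) (hd : ∀ α ∈ A, ∀ v, formG A c (d α) v = α v)
    {B : Finset (Dual ℂ V)} {ξ : V} (hξ : ∀ α ∈ outside A B, Complex.sin (α ξ) ≠ 0)
    {u v : V} (hu : u ∈ commonKer B) (hv : v ∈ commonKer B) (w z : V) :
    formG A c v w * formG A c u z + lam ^ 2 / 4 *
        formG A c (cotVec (outside A B) c id d ξ u z) (cotVec (outside A B) c id d ξ v w) =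
      formG A c u w * formG A c v z + lam ^ 2 / 4 *
        formG A c (cotVec (outside A B) c id d ξ v z) (cotVec (outside A B) c id d ξ u w) := by
  obtain ⟨h, -, hh⟩ := Dual.exists_forall_mem_ne_zero_of_forall_exists (⊤ : Submodule ℂ V)
    (fun α : A => (α : Dual ℂ V)) (by
      rintro ⟨α, hα⟩
      obtain ⟨b, hb⟩ := DFunLike.ne_iff.1 (fun h => hA (h ▸ hα) : α ≠ 0)
      exact ⟨b, trivial, hb⟩)
  have hgen : ∀ᶠ t : ℂ in 𝓝[≠] 0, ∀ α ∈ A, Complex.sin (α (ξ + t • h)) ≠ 0 := by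
    refine (eventually_all_finset A).2 fun α hα => ?_
    simp only [map_add, map_smul, smul_eq_mul]
    exact eventually_sin_ne_zero (Or.inr (hh ⟨α, hα⟩))
  have hred : ∀ a ∈ commonKer B, ∀ y a', cotVec A c id d y a a' =
      cotVec (outside A B) c id d y a a' := by
    refine fun a ha y a' => cotVec_subset (outside_subset A B) (fun α hα hα' => ?_) y a'
    by_contra h0
    exact hα' (mem_outside.2 ⟨hα, fun hαB => h0 (mem_commonKer.1 ha α hαB)⟩)
  have hlim := fun a b a' b' : V => (tendsto_sumForm_cotVec (s := outside A B) (c := c) (γ := id)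
    (d := d) (G := formG A c) (x := ξ) hξ h a b a' b').const_mul (lam ^ 2 / 4)
  refine tendsto_nhds_unique ((hlim u z v w).const_add _)
    (((hlim v z u w).const_add _).congr' ?_)
  filter_upwards [hgen] with t ht
  have h1 := symm_of_satisfiesWDVV e hG hF hd ht u v w z
  rw [hred u hu, hred v hv, hred v hv, hred u hu] at h1
  exact h1.symm

lemma sumForm_restr (B : Finset (Dual ℂ V)) :
    sumForm (outside A B) c (restr B) = (formG A c).restrict (commonKer B) := by
  refine LinearMap.ext₂ fun u v => ?_
  have h := sumForm_apply A c id (u : V) (v : V)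
  change _ = formG A c (u : V) (v : V)
  refine (sumForm_apply _ _ _ _ _).trans (Eq.trans ?_ h.symm)
  refine Finset.sum_subset (outside_subset A B) fun α hα hα' => ?_
  have h0 : α (u : V) = 0 := by
    by_contra h0
    exact hα' (mem_outside.2 ⟨hα, fun hαB => h0 (mem_commonKer.1 u.2 α hαB)⟩)
  change c α * (α (u : V) * α (v : V)) = 0
  rw [h0, zero_mul, mul_zero]

end Restriction

theorem mainTheorem2 {V : Type*} [AddCommGroup V] [Module ℂ V] [FiniteDimensional ℂ V]
    {N : ℕ} (e : Module.Basis (Fin N) ℂ V)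
    (A : Finset (Module.Dual ℂ V)) (c : Module.Dual ℂ V → ℂ) (lam : ℂ) (hlam : lam ≠ 0)
    (hA : 0 ∉ A) (hlattice : InLattice A N) (hG : (formG A c).Nondegenerate)
    (B S : Finset (Module.Dual ℂ V)) (hB : IsSubsystem A B) (hS : IsSpanBasis S B)
    (hGB : ((formG A c).restrict (commonKer B)).Nondegenerate)
    (hC : ∀ α ∈ S, ∀ α₀ ∈ collinearSet A α, collinearConst (collinearSet A α) c α₀ ≠ 0)
    (hF : SatisfiesWDVV e A c id lam)
    {n : ℕ} (f : Module.Basis (Fin n) ℂ (commonKer B)) :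
    SatisfiesWDVV f (outside A B) c (restr B) lam ∧
    ∀ (ξ : commonKer B) (y : ℂ), (∀ α ∈ outside A B, Complex.sin (restr B α ξ) ≠ 0) →
      ∀ g : Module.Dual ℂ V → ℂ → ℂ, (∀ α ∈ outside A B, IsBranch (g α) (restr B α ξ)) →
        (∀ u v w : commonKer B × ℂ,
          wdvvMul f (prepotential (outside A B) c (restr B) lam g) (ξ, y)
              (wdvvMul f (prepotential (outside A B) c (restr B) lam g) (ξ, y) u v) w =
            wdvvMul f (prepotential (outside A B) c (restr B) lam g) (ξ, y) u
              (wdvvMul f (prepotential (outside A B) c (restr B) lam g) (ξ, y) v w)) ∧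
        ∀ u v : commonKer B,
          wdvvMul f (prepotential (outside A B) c (restr B) lam g) (ξ, y) (u, 0) (v, 0) =
            ∑ α ∈ outside A B, (c α * restr B α u * restr B α v) •
              ((lam / 2 * Complex.cot (restr B α ξ)) •
                ((((formG A c).restrict (commonKer B)).toDual hGB).symm (restr B α), (0 : ℂ)) +
                (0, 1)) := by
  set d : Dual ℂ V → V := fun α => ((formG A c).toDual hG).symm α
  have hd : ∀ α ∈ A, ∀ v, formG A c (d α) v = α v :=
    fun α _ v => LinearMap.BilinForm.apply_toDual_symm_apply α v
  set d' : Dual ℂ V → commonKer B :=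
    fun α => (((formG A c).restrict (commonKer B)).toDual hGB).symm (restr B α) with hd'_def
  have hform := sumForm_restr (A := A) (c := c) B
  have hG' : (sumForm (outside A B) c (restr B)).Nondegenerate := by rw [hform]; exact hGB
  have hd' : ∀ α ∈ outside A B, ∀ v, sumForm (outside A B) c (restr B) (d' α) v =
      restr B α v := fun α _ v => by
    rw [hform]
    exact LinearMap.BilinForm.apply_toDual_symm_apply (restr B α) v
  have hform' : ∀ u v : commonKer B, sumForm (outside A B) c (restr B) u v =
      formG A c (u : V) (v : V) := fun u v => by rw [hform]; rfl
  have hcomm : ∀ ξ : commonKer B, (∀ α ∈ outside A B, Complex.sin (restr B α ξ) ≠ 0) →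
      ∀ a b : commonKer B × ℂ,
        Commute (tangentMul (outside A B) c (restr B) lam d' ξ a)
          (tangentMul (outside A B) c (restr B) lam d' ξ b) := by
    intro ξ hξ
    have hcot : ∀ u v : commonKer B, ((cotVec (outside A B) c (restr B) d' ξ u v : commonKer B) : V) =
        cotVec (outside A B) c id d (ξ : V) (u : V) (v : V) := by
      intro u v
      have hmem := cotVec_mem_commonKer e hlam hA hG hF hd hB hS hC ξ.2 hξ u.2 v.2
      refine congrArg Subtype.val (a₂ := ⟨_, hmem⟩) (sub_eq_zero.1 (hG'.1 _ fun w => ?_))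
      rw [map_sub, LinearMap.sub_apply, sub_eq_zero, sumForm_cotVec ξ hd', hform']
      change _ = formG A c (cotVec (outside A B) c id d (ξ : V) (u : V) (v : V)) (w : V)
      rw [cotVec, map_sum, LinearMap.sum_apply]
      refine Finset.sum_congr rfl fun α hα => ?_
      rw [map_smul, LinearMap.smul_apply, hd α (outside_subset A B hα), smul_eq_mul]
      change c α * (α u * α v * α w * Complex.cot (α ξ)) =
        c α * (α u * α v * Complex.cot (α ξ)) * α w
      ring
    refine (commute_tangentMul_iff lam ξ hG' hd').2 fun u v w z => ?_
    simp only [hform', hcot]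
    exact symm_on_commonKer e hA hG hF hd hξ u.2 v.2 w z
  refine ⟨fun ξ y hξ g hg => (wdvvAt_iff f hG' hd' hg).2 (hcomm ξ hξ), fun ξ y hξ g hg =>
    ⟨fun u v w => ?_, fun u v => ?_⟩⟩
  · simp only [wdvvMul_eq_tangentMul f hG' hd' (p := (ξ, y)) hg]
    rw [tangentMul_comm _ _ _ _ _ _ _ w, tangentMul_comm _ _ _ _ _ _ v w]
    exact LinearMap.congr_fun (hcomm ξ hξ w u).eq v
  · rw [wdvvMul_eq_tangentMul f hG' hd' (p := (ξ, y)) hg, tangentMul_apply]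
    refine Prod.ext ?_ ?_
    · simp only [zero_smul, zero_add, cotVec, Finset.smul_sum, smul_smul, Prod.fst_sum,
        Prod.smul_fst, Prod.fst_add, add_zero]
      exact Finset.sum_congr rfl fun α _ => by congr 1; ring
    · simp [sumForm_apply, Prod.snd_sum, mul_assoc]
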